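/- Let $f$ be one of the functions $\ln, \sin, \cos, \tan, \csc, \sec, \cot, \sinh, \cosh, \tanh, \coth$ of a complex variable, where $\ln$ may be any determination of the complex logarithm, that is, any choice of a value $\ln z$ with $e^{\ln z}=z$ for each $z\neq 0$. Let $g$ be a polynomial with rational coefficients of degree at least $1$ and let $h\in\mathbb{Q}[x]$. If the equation $g(f(x))=h(x)$ has a nonzero solution $\alpha\in\mathbb{C}$ (at which $f$ is defined) such that $f(\alpha)\neq 0$ and $g(f(\alpha))\neq 0$, then $\alpha$ is transcendental (over $\mathbb{Q}$). -/

import Mathlib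

/-- A determination of the complex logarithm: a choice, for every nonzero `z`, of a value `w` with
`exp w = z`. The principal logarithm is one, and every branch of the logarithm on a
subset of the punctured plane extends to one. The value at `0`, where `ln` is undefined, is left
free. -/
def IsLogDetermination (f : ℂ → ℂ) : Prop :=
  ∀ z : ℂ, z ≠ 0 → Complex.exp (f z) = z

/-- `f` is one of `ln, sin, cos, tan, csc, sec, cot, sinh, cosh, tanh, coth`, as a function of a
complex variable. The quotients `tan, csc, …` are undefined at their poles; there Lean's division
convention gives them the value `0`. -/
inductive IsLogTrigHyp : (ℂ → ℂ) → Prop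
  | ln (f : ℂ → ℂ) (hf : IsLogDetermination f) : IsLogTrigHyp f
  | sin : IsLogTrigHyp (fun z => Complex.sin z)
  | cos : IsLogTrigHyp (fun z => Complex.cos z)
  | tan : IsLogTrigHyp (fun z => Complex.sin z / Complex.cos z)
  | csc : IsLogTrigHyp (fun z => 1 / Complex.sin z)
  | sec : IsLogTrigHyp (fun z => 1 / Complex.cos z)
  | cot : IsLogTrigHyp (fun z => Complex.cos z / Complex.sin z)
  | sinh : IsLogTrigHyp (fun z => Complex.sinh z)
  | cosh : IsLogTrigHyp (fun z => Complex.cosh z)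
  | tanh : IsLogTrigHyp (fun z => Complex.sinh z / Complex.cosh z)
  | coth : IsLogTrigHyp (fun z => Complex.cosh z / Complex.sinh z)

/-! If `α` were algebraic, so would be `h(α) = g(f(α))`, hence `f(α)`, as `g` is nonconstant. By
Hermite–Lindemann (`transcendental_exp`), however, a nonzero value of `f` at a nonzero algebraic
point is transcendental.

Hermite–Lindemann: an integer polynomial relation for `exp α` is an element of the group ring
`ℤ[K]`, `K` a Galois field containing `α`. The product of its conjugates is a Galois-invariant
relation, which can be shifted to involve `exp 0`. `sum_intCast_mul_exp_ne_zero` excludes this: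
Hermite's simultaneous approximations to the exponentials yield an integer of absolute value below 1
that is nonzero modulo a large prime. -/

/-! ### Galois-invariant relations between exponentials -/

open Polynomial in
theorem isIntegral_pow_smul_aeval {R S : Type*} [CommRing R] [CommRing S] [Algebra R S] {a : R}
    {x : S} (hx : IsIntegral R (a • x)) (g : R[X]) {N : ℕ} (hN : g.natDegree ≤ N) :
    IsIntegral R (a ^ N • aeval x g) := by
  rw [aeval_eq_sum_range, Finset.smul_sum]
  refine IsIntegral.sum _ fun i hi => ?_
  have hi' : i ≤ N := (Nat.lt_succ_iff.mp (Finset.mem_range.mp hi)).trans hN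
  have : a ^ N • g.coeff i • x ^ i = (a ^ (N - i) * g.coeff i) • (a • x) ^ i := by
    rw [_root_.smul_pow, smul_smul, smul_smul, ← Nat.sub_add_cancel hi', pow_add]
    congr 1
    rw [Nat.add_sub_cancel]
    ring
  rw [this]
  exact (hx.pow i).smul _

-- The product serves all exponents at once in Hermite's approximation, which needs a nonzero value
-- at 0.
open Polynomial in
theorem exists_eval_zero_ne_zero_and_aeval_eq_zero {K : Type*} [Field K] [CharZero K]
    [Algebra.IsAlgebraic ℤ K] (s : Finset K) (hs : (0 : K) ∉ s) :
    ∃ f : ℤ[X], f.eval 0 ≠ 0 ∧ ∀ k ∈ s, aeval k f = 0 := by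
  have key : ∀ k : K, ∃ f : ℤ[X], (k ≠ 0 → f.eval 0 ≠ 0) ∧ (k ≠ 0 → aeval k f = 0) := by
    intro k
    by_cases hk : k = 0
    · exact ⟨0, fun h => absurd hk h, fun h => absurd hk h⟩
    · have hk' : IsAlgebraic ℤ k := Algebra.IsAlgebraic.isAlgebraic k
      obtain ⟨f, hf, h0⟩ := hk'.exists_nonzero_coeff_and_aeval_eq_zero
        (mem_nonZeroDivisors_of_ne_zero hk)
      exact ⟨f, fun _ => by rwa [← coeff_zero_eq_eval_zero], fun _ => h0⟩
  choose f hf using key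
  have hne : ∀ k ∈ s, k ≠ 0 := fun k hk h => hs (h ▸ hk)
  refine ⟨∏ k ∈ s, f k, ?_, fun k hk => ?_⟩
  · rw [eval_prod, Finset.prod_ne_zero_iff]
    exact fun k hk => (hf k).1 (hne k hk)
  · rw [map_prod]
    exact Finset.prod_eq_zero hk ((hf k).2 (hne k hk))

open Filter in
theorem eventually_mul_pow_div_factorial_pred_lt_one (B C : ℝ) :
    ∀ᶠ p : ℕ in atTop, B * (C ^ p / (p - 1).factorial) < 1 := by
  have h := (FloorSemiring.tendsto_pow_div_factorial_atTop C).const_mul (B * C)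
  rw [mul_zero] at h
  have h2 := (h.comp (tendsto_sub_atTop_nat 1)).eventually (gt_mem_nhds one_pos)
  filter_upwards [h2, eventually_ge_atTop 1] with p hp h1
  obtain ⟨q, rfl⟩ := Nat.exists_eq_add_of_le' h1
  simp only [Function.comp_apply, Nat.add_sub_cancel] at hp ⊢
  calc B * (C ^ (q + 1) / q.factorial) = B * C * (C ^ q / q.factorial) := by ring
    _ < 1 := hp

open Polynomial in
/-- If the integer coefficients `c` are invariant under the Galois group of `K`, then the sum of a
polynomial over a Galois-stable set, weighted by `c`, becomes an integer once the denominators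
are cleared. -/
theorem exists_int_eq_pow_mul_sum_aeval {K : Type*} [Field K] [CharZero K] [Algebra ℚ K]
    [FiniteDimensional ℚ K] [IsGalois ℚ K] (s : Finset K) (c : K → ℤ)
    (hs : ∀ (σ : Gal(K/ℚ)) (k : K), σ k ∈ s ↔ k ∈ s) (hc : ∀ (σ : Gal(K/ℚ)) (k : K), c (σ k) = c k)
    {a : ℤ} (ha : ∀ k ∈ s, IsIntegral ℤ (a • k)) (g : ℤ[X]) {N : ℕ} (hN : g.natDegree ≤ N) :
    ∃ m : ℤ, (m : K) = a ^ N * ∑ k ∈ s, c k * aeval k g := by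
  set T : K := ∑ k ∈ s, c k * aeval k g with hT
  have hfix : ∀ σ : Gal(K/ℚ), σ T = T := by
    intro σ
    rw [hT, map_sum]
    refine Finset.sum_equiv σ.toEquiv (fun k => (hs σ k).symm) fun k _ => ?_
    have : σ (aeval k g) = aeval (σ k) g := by
      simpa using (aeval_algHom_apply (σ.toAlgHom.restrictScalars ℤ) k g).symm
    simp [this, hc]
  obtain ⟨t, ht⟩ := IntermediateField.mem_bot.mp ((IsGalois.mem_bot_iff_fixed T).mpr hfix)
  rw [eq_ratCast] at ht
  have hint : IsIntegral ℤ ((a : K) ^ N * T) := by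
    rw [hT, Finset.mul_sum]
    refine IsIntegral.sum _ fun k hk => ?_
    have := (isIntegral_pow_smul_aeval (ha k hk) g hN).smul (c k)
    convert this using 1
    simp only [zsmul_eq_mul]
    push_cast
    ring
  have hq : IsIntegral ℤ ((a : ℚ) ^ N * t) := by
    rw [← isIntegral_algebraMap_iff (algebraMap ℚ K).injective (R := ℤ)]
    simpa [ht] using hint
  obtain ⟨m, hm⟩ := IsIntegrallyClosed.isIntegral_iff.mp hq
  refine ⟨m, ?_⟩
  have := congrArg (algebraMap ℚ K) hm
  simpa [ht] using this

open Polynomial in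
/-- A nontrivial relation between exponentials with Galois-invariant integer coefficients cannot
involve the exponential of `0`. -/
theorem sum_intCast_mul_exp_ne_zero {K : Type*} [Field K] [CharZero K] [Algebra ℚ K]
    [FiniteDimensional ℚ K] [IsGalois ℚ K] (φ : K →+* ℂ) (F : K →₀ ℤ)
    (hF : ∀ (σ : Gal(K/ℚ)) (k : K), F (σ k) = F k) (h0 : F 0 ≠ 0) :
    F.sum (fun k n => (n : ℂ) * Complex.exp (φ k)) ≠ 0 := by
  classical
  intro H
  set s := F.support.erase 0 with hs
  have hs0 : (0 : K) ∉ s := by simp [hs]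
  have hmem : ∀ (σ : Gal(K/ℚ)) (k : K), σ k ∈ s ↔ k ∈ s := by
    intro σ k
    simp [hs, hF]
  have H' : (F 0 : ℂ) + ∑ k ∈ s, F k * Complex.exp (φ k) = 0 := by
    rw [Finsupp.sum, ← Finset.add_sum_erase _ _ (Finsupp.mem_support_iff.mpr h0)] at H
    simpa using H
  have : Algebra.IsAlgebraic ℤ K :=
    (IsFractionRing.comap_isAlgebraic_iff (K := ℚ)).mpr inferInstance
  obtain ⟨f, hf0, hf⟩ := exists_eval_zero_ne_zero_and_aeval_eq_zero s hs0
  have hfne : f ≠ 0 := by rintro rfl; simp at hf0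
  obtain ⟨c, hc⟩ := LindemannWeierstrass.exp_polynomial_approx f hf0
  set a := f.leadingCoeff with ha
  have ha0 : a ≠ 0 := leadingCoeff_ne_zero.mpr hfne
  set B : ℝ := ∑ k ∈ s, |(F k : ℝ)| with hB
  obtain ⟨p₀, hp₀⟩ := Filter.eventually_atTop.mp
    (eventually_mul_pow_div_factorial_pred_lt_one B (|(a : ℝ)| ^ f.natDegree * c))
  -- `p₀` makes the error small, `f.eval 0` is needed by the approximation, and `a` and `F 0` must
  -- not be divisible by `p`.
  obtain ⟨p, hpge, hp⟩ := Nat.exists_infinite_primes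
    (p₀ + (f.eval 0).natAbs + a.natAbs + (F 0).natAbs + 1)
  obtain ⟨n, hn, g, hg, hroot⟩ := hc p (by omega) hp
  have hsmall := hp₀ p (by omega)
  obtain ⟨m, hm⟩ := exists_int_eq_pow_mul_sum_aeval s F hmem hF
    (fun k hk => isIntegral_leadingCoeff_smul f k (hf k hk)) g (hg.trans (Nat.sub_le _ _))
  rw [← ha] at hm
  set N := p * f.natDegree with hN
  have hmC : (m : ℂ) = a ^ N * ∑ k ∈ s, F k * aeval (φ k) g := by
    have := congrArg φ hm
    have h2 : ∀ k, φ (aeval k g) = aeval (φ k) g := fun k => by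
      simpa using (aeval_algHom_apply φ.toIntAlgHom k g).symm
    simpa [h2] using this
  have hnorm : ‖(n : ℂ) * F 0 + p * ∑ k ∈ s, F k * aeval (φ k) g‖ ≤
      B * (c ^ p / (p - 1).factorial) := by
    have e : (n : ℂ) * F 0 + p * ∑ k ∈ s, F k * aeval (φ k) g =
        -∑ k ∈ s, (F k : ℂ) * (n • Complex.exp (φ k) - p • aeval (φ k) g) := by
      simp only [zsmul_eq_mul, nsmul_eq_mul, mul_sub, Finset.sum_sub_distrib]
      have e1 : ∑ k ∈ s, (F k : ℂ) * (n * Complex.exp (φ k)) = -(n * F 0) := by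
        rw [eq_neg_iff_add_eq_zero, ← mul_zero (n : ℂ), ← H', mul_add, add_comm, Finset.mul_sum]
        congr 1
        exact Finset.sum_congr rfl fun k _ => by ring
      rw [e1, Finset.mul_sum]
      simp only [mul_left_comm]
      ring
    rw [e, norm_neg, hB, Finset.sum_mul]
    refine norm_sum_le_of_le _ fun k hk => ?_
    rw [norm_mul, Complex.norm_intCast]
    gcongr
    refine hroot ?_
    rw [mem_aroots]
    refine ⟨hfne, ?_⟩
    have := aeval_algHom_apply φ.toIntAlgHom k f
    simpa [hf k hk] using this
  -- The relation cancels the exponentials, leaving only the approximation errors, scaled by `a ^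
  -- N`.
  have hz : a ^ N * n * F 0 + p * m = 0 := by
    rw [← Int.abs_lt_one_iff, ← Int.cast_lt (R := ℝ), Int.cast_abs, ← Complex.norm_intCast]
    have e : ((a ^ N * n * F 0 + p * m : ℤ) : ℂ) =
        a ^ N * ((n : ℂ) * F 0 + p * ∑ k ∈ s, F k * aeval (φ k) g) := by
      push_cast
      rw [hmC]
      ring
    rw [e, norm_mul, norm_pow, Complex.norm_intCast]
    calc _ ≤ |(a : ℝ)| ^ N * (B * (c ^ p / (p - 1).factorial)) := by gcongr
      _ = B * ((|(a : ℝ)| ^ f.natDegree * c) ^ p / (p - 1).factorial) := by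
        rw [hN, mul_comm p, pow_mul, mul_pow]; ring
      _ < _ := by simpa using hsmall
  have hpZ : Prime (p : ℤ) := Nat.prime_iff_prime_int.mp hp
  have hdvd : (p : ℤ) ∣ a ^ N * n * F 0 :=
    ⟨-m, by linear_combination hz⟩
  rcases hpZ.dvd_or_dvd hdvd with h | h
  · rcases hpZ.dvd_or_dvd h with h | h
    · have := Nat.le_of_dvd (Int.natAbs_pos.mpr ha0) (Int.natCast_dvd.mp (hpZ.dvd_of_dvd_pow h))
      omega
    · exact hn h
  · have := Nat.le_of_dvd (Int.natAbs_pos.mpr h0) (Int.natCast_dvd.mp h)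
    omega

/-! ### The Hermite–Lindemann theorem -/

open Polynomial AddMonoidAlgebra in
/-- The **Hermite–Lindemann theorem**. -/
theorem transcendental_exp {α : ℂ} (hα : IsAlgebraic ℚ α) (h0 : α ≠ 0) :
    Transcendental ℚ (Complex.exp α) := by
  classical
  intro hβ
  obtain ⟨b, hb0, hb⟩ := (IsFractionRing.isAlgebraic_iff ℤ ℚ ℂ).mpr hβ
  let K := IntermediateField.adjoin ℚ ((minpoly ℚ α).rootSet ℂ)
  have : IsSplittingField ℚ K (minpoly ℚ α) :=
    IntermediateField.adjoin_rootSet_isSplittingField (IsAlgClosed.splits _)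
  have : FiniteDimensional ℚ K := IsSplittingField.finiteDimensional K (minpoly ℚ α)
  have : Normal ℚ K := Normal.of_isSplittingField (minpoly ℚ α)
  have : IsGalois ℚ K := ⟨⟩
  let a : K := ⟨α, IntermediateField.subset_adjoin _ _ <|
    mem_rootSet.mpr ⟨minpoly.ne_zero hα.isIntegral, minpoly.aeval _ _⟩⟩
  have ha0 : a ≠ 0 := fun h => h0 (congrArg Subtype.val h)
  let φ : K →+* ℂ := algebraMap K ℂ
  let E : AddMonoidAlgebra ℤ K →ₐ[ℤ] ℂ := AddMonoidAlgebra.lift ℤ ℂ K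
    (Complex.expMonoidHom.comp (AddMonoidHom.toMultiplicative φ.toAddMonoidHom))
  have hE : ∀ x : AddMonoidAlgebra ℤ K,
      E x = x.coeff.sum fun k n => (n : ℂ) * Complex.exp (φ k) := by
    intro x
    simp [E, AddMonoidAlgebra.lift_apply]
  have hEs : ∀ k : K, E (single k 1) = Complex.exp (φ k) := by
    intro k
    simp [E]
  let D : Gal(K/ℚ) → AddMonoidAlgebra ℤ K ≃ₐ[ℤ] AddMonoidAlgebra ℤ K := fun σ =>
    domCongr ℤ ℤ (σ : K ≃+ K)
  have hD : ∀ σ x k, (D σ x).coeff (σ k) = x.coeff k := by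
    intro σ x k
    simp only [D, coeff_domCongr]
    congr 1
    exact σ.symm_apply_apply k
  let u : AddMonoidAlgebra ℤ K := aeval (single a 1) b
  have hEu : E u = 0 := by
    rw [← aeval_algHom_apply, hEs]
    exact hb
  have hu0 : u ≠ 0 := by
    intro hu
    apply hb0
    ext j
    have h1 : u = ∑ i ∈ Finset.range (b.natDegree + 1), single (i • a) (b.coeff i) := by
      simp [u, aeval_eq_sum_range, single_pow]
    have hinj : Function.Injective fun n : ℕ => n • a := fun m n h => by
      simpa [ha0] using h
    have h2 : u.coeff (j • a) = b.coeff j := by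
      rw [h1]
      simp only [AddMonoidAlgebra.coeff_sum, coeff_single, Finsupp.coe_finsetSum,
        Finset.sum_apply,
        Finsupp.single_apply, hinj.eq_iff, Finset.sum_ite_eq',
        Finset.mem_range, Nat.lt_succ_iff, ite_eq_left_iff, not_le]
      exact fun h => (coeff_eq_zero_of_natDegree_lt h).symm
    rw [← h2, hu]
    rfl
  let P := ∏ σ, D σ u
  -- `ℤ[K]` has no zero divisors, since the additive group of `K` is torsion-free.
  have hP0 : P ≠ 0 := Finset.prod_ne_zero_iff.mpr fun σ _ => by simpa using hu0
  have hEP : E P = 0 := by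
    rw [map_prod]
    refine Finset.prod_eq_zero (Finset.mem_univ 1) ?_
    have : D 1 u = u := by
      ext k
      exact hD 1 u k
    rw [this, hEu]
  have hDmul : ∀ σ τ x, D σ (D τ x) = D (σ * τ) x := by
    intro σ τ x
    ext k
    obtain ⟨k, rfl⟩ := (σ * τ).surjective k
    rw [hD, AlgEquiv.mul_apply, hD, hD]
  have hDP : ∀ σ, D σ P = P := by
    intro σ
    rw [map_prod]
    exact Fintype.prod_equiv (Equiv.mulLeft σ) _ _ fun τ => hDmul σ τ u
  obtain ⟨k₀, hk₀⟩ : ∃ k, P.coeff k ≠ 0 := by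
    by_contra! h
    exact hP0 (by ext k; exact h k)
  -- By invariance of `P`, the coefficient of `V * P` at 0 is the group order times that of `P` at
  -- `k₀`.
  let V : AddMonoidAlgebra ℤ K := ∑ σ : Gal(K/ℚ), single (-σ k₀) 1
  have hDV : ∀ σ, D σ V = V := by
    intro σ
    rw [map_sum]
    refine Fintype.sum_equiv (Equiv.mulLeft σ) _ _ fun τ => ?_
    simp only [D, domCongr_single, map_neg]
    rfl
  refine sum_intCast_mul_exp_ne_zero φ (V * P).coeff (fun σ k => ?_) ?_
    (by rw [← hE, map_mul, hEP, mul_zero])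
  · conv_lhs => rw [← hDV σ, ← hDP σ, ← map_mul]
    exact hD σ _ k
  · have hP : ∀ σ : Gal(K/ℚ), P.coeff (σ k₀) = P.coeff k₀ := fun σ => by
      conv_lhs => rw [← hDP σ]
      exact hD σ _ _
    simp only [V, Finset.sum_mul, AddMonoidAlgebra.coeff_sum, Finsupp.coe_finsetSum,
      Finset.sum_apply, coeff_single_mul_apply]
    simp [hP, hk₀]

/-! ### Logarithm, trigonometric and hyperbolic functions -/

section TrigAlgebraic

variable {F A : Type*} [Field F] [Field A] [Algebra F A] {c s : A}

theorem IsAlgebraic.of_sq_add_sq_eq_one (h : c ^ 2 + s ^ 2 = 1) (hs : IsAlgebraic F s) :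
    IsAlgebraic F c := by
  refine IsAlgebraic.of_pow two_pos ?_
  rw [eq_sub_of_add_eq h]
  exact isAlgebraic_one.sub (hs.pow 2)

theorem IsAlgebraic.of_div_of_sq_add_sq_eq_one (h : c ^ 2 + s ^ 2 = 1) (h0 : s / c ≠ 0)
    (ht : IsAlgebraic F (s / c)) : IsAlgebraic F s := by
  -- Division by zero gives 0, so a nonzero quotient excludes `c = 0`.
  have hc : c ≠ 0 := fun hc => h0 (by simp [hc])
  have hc' : IsAlgebraic F c := by
    refine IsAlgebraic.of_pow two_pos ?_
    have : c ^ 2 = (1 + (s / c) ^ 2)⁻¹ := by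
      rw [div_pow, ← div_self (pow_ne_zero 2 hc), ← add_div, h, inv_div, div_one]
    rw [this]
    exact (isAlgebraic_one.add (ht.pow 2)).inv
  rw [← div_mul_cancel₀ s hc]
  exact ht.mul hc'

end TrigAlgebraic

open Complex in
theorem transcendental_sin {α : ℂ} (hα : IsAlgebraic ℚ α) (h0 : α ≠ 0) :
    Transcendental ℚ (sin α) := by
  intro hs
  have hI : IsAlgebraic ℚ I := isIntegral_rat_I.isAlgebraic
  refine transcendental_exp (hα.mul hI) (mul_ne_zero h0 I_ne_zero) ?_
  rw [exp_mul_I]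
  exact (hs.of_sq_add_sq_eq_one (cos_sq_add_sin_sq α)).add (hs.mul hI)

open Complex in
theorem transcendental_cos {α : ℂ} (hα : IsAlgebraic ℚ α) (h0 : α ≠ 0) :
    Transcendental ℚ (cos α) := fun hc =>
  transcendental_sin hα h0 (hc.of_sq_add_sq_eq_one (sin_sq_add_cos_sq α))

open Complex in
theorem transcendental_sinh {α : ℂ} (hα : IsAlgebraic ℚ α) (h0 : α ≠ 0) :
    Transcendental ℚ (sinh α) := by
  intro hs
  have hI : IsAlgebraic ℚ I := isIntegral_rat_I.isAlgebraic
  refine transcendental_sin (hα.mul hI) (mul_ne_zero h0 I_ne_zero) ?_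
  rw [sin_mul_I]
  exact hs.mul hI

open Complex in
theorem transcendental_cosh {α : ℂ} (hα : IsAlgebraic ℚ α) (h0 : α ≠ 0) :
    Transcendental ℚ (cosh α) := by
  have hI : IsAlgebraic ℚ I := isIntegral_rat_I.isAlgebraic
  rw [← cos_mul_I]
  exact transcendental_cos (hα.mul hI) (mul_ne_zero h0 I_ne_zero)

open Complex in
theorem transcendental_tan {α : ℂ} (hα : IsAlgebraic ℚ α) (h0 : α ≠ 0)
    (ht : sin α / cos α ≠ 0) : Transcendental ℚ (sin α / cos α) := fun h =>
  transcendental_sin hα h0 (h.of_div_of_sq_add_sq_eq_one (cos_sq_add_sin_sq α) ht)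

open Complex in
theorem transcendental_tanh {α : ℂ} (hα : IsAlgebraic ℚ α) (h0 : α ≠ 0)
    (ht : sinh α / cosh α ≠ 0) : Transcendental ℚ (sinh α / cosh α) := by
  have hI : IsAlgebraic ℚ I := isIntegral_rat_I.isAlgebraic
  have e : sin (α * I) / cos (α * I) = sinh α / cosh α * I := by
    rw [sin_mul_I, cos_mul_I, div_mul_eq_mul_div]
  intro h
  refine transcendental_tan (hα.mul hI) (mul_ne_zero h0 I_ne_zero) ?_ (e ▸ h.mul hI)
  rw [e]
  exact mul_ne_zero ht I_ne_zero

/-- At a nonzero algebraic point, each of the functions takes only `0` and transcendental values. -/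
theorem IsLogTrigHyp.transcendental {f : ℂ → ℂ} (hf : IsLogTrigHyp f) {α : ℂ}
    (hα : IsAlgebraic ℚ α) (h0 : α ≠ 0) (hfα : f α ≠ 0) : Transcendental ℚ (f α) := by
  cases hf with
  -- Here `f α` is the exponent, and `exp (f α) = α` is the algebraic value.
  | ln f hf => exact fun h => transcendental_exp h hfα (by rwa [hf α h0])
  | sin => exact transcendental_sin hα h0
  | cos => exact transcendental_cos hα h0
  | tan => exact transcendental_tan hα h0 hfα
  | csc => exact fun h => transcendental_sin hα h0 (by simpa using h.inv)
  | sec => exact fun h => transcendental_cos hα h0 (by simpa using h.inv)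
  | cot =>
    refine fun h => transcendental_tan hα h0 ?_ (by simpa using h.inv)
    simpa using inv_ne_zero hfα
  | sinh => exact transcendental_sinh hα h0
  | cosh => exact transcendental_cosh hα h0
  | tanh => exact transcendental_tanh hα h0 hfα
  | coth =>
    refine fun h => transcendental_tanh hα h0 ?_ (by simpa using h.inv)
    simpa using inv_ne_zero hfα

/-- The element `g` of `ℚ[f(x)]` is given by the polynomial `g` over `ℚ` of degree at least one that
is evaluated at `f(x)`. At a pole of `f` the hypothesis `f α ≠ 0` fails, so `α` is a genuine
solution of `g(f(x)) = h(x)`. -/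
theorem corollary1 (f : ℂ → ℂ) (hf : IsLogTrigHyp f) (g h : Polynomial ℚ)
    (hg : 1 ≤ g.natDegree) (α : ℂ) (hα : α ≠ 0)
    (hsol : Polynomial.aeval (f α) g = Polynomial.aeval α h)
    (hfα : f α ≠ 0) (hgα : Polynomial.aeval (f α) g ≠ 0) :
    Transcendental ℚ α := by
  intro (h_alg : IsAlgebraic ℚ α)
  refine hf.transcendental h_alg hα hfα (IsAlgebraic.of_aeval g (by omega) ?_ ?_)
  · exact mem_nonZeroDivisors_of_ne_zero (Polynomial.leadingCoeff_ne_zero.mpr (by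
      rintro rfl
      simp at hg))
  · rw [hsol]
    rw [Polynomial.aeval_eq_sum_range]
    exact (IsIntegral.sum _ fun i _ => (h_alg.isIntegral.pow i).smul _).isAlgebraic
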